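/- Let $\mathcal X$ be a set of datasets with a symmetric neighbouring relation $\sim$. A mechanism $M$ assigns to each $x\in\mathcal X$ the law of a random outcome $M(x)$ in a measurable space $\mathcal Y$. It is $(\varepsilon,\delta)$-DP if $\Pr[M(x)\in S]\le e^{\varepsilon}\Pr[M(x')\in S]+\delta$ for all $x\sim x'$ and all events $S\subseteq\mathcal Y$. It is $\varepsilon$-DP if it is $(\varepsilon,0)$-DP. It is $\varepsilon$-bounded range ($\varepsilon$-BR) if $$\Pr[M(x)\in S_1]\,\Pr[M(x')\in S_2]\le e^{\varepsilon}\,\Pr[M(x)\in S_2]\,\Pr[M(x')\in S_1]$$ for all $x\sim x'$ and all events $S_1,S_2\subseteq\mathcal Y$. For $\varepsilon_g\in\mathbb R$ put $\delta_{\mathrm{opt}}(M;\varepsilon_g)=\inf\{\delta\ge 0: M\text{ is }(\varepsilon_g,\delta)\text{-DP}\}$, and for a class $\mathcal M$ of mechanisms put $\delta_{\mathrm{opt}}(\mathcal M;\varepsilon_g)=\sup_{M\in\mathcal M}\delta_{\mathrm{opt}}(M;\varepsilon_g)$. Fix $\varepsilon>0$. Let $\mathrm{BR}$ and $\mathrm{DP}$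 denote the classes of all $\varepsilon$-BR and of all $\varepsilon$-DP mechanisms. For a finite sequence $\mathcal C_1,\dots,\mathcal C_k\in\{\mathrm{BR},\mathrm{DP}\}$ fixed in advance, let $(\mathcal C_1,\dots,\mathcal C_k)$ be the class of adaptively composed mechanisms $x\mapsto(Y_1,\dots,Y_k)$ with $Y_i=M_i(x,Y_1,\dots,Y_{i-1})$, where for all values $y_1,\dots,y_{i-1}$ of the earlier outcomes the mechanism $M_i(\cdot,y_1,\dots,y_{i-1})$ belongs to $\mathcal C_i$ (and depends measurably on $y_1,\dots,y_{i-1}$). **Proposition.** Let $\varepsilon_g\ge 0$. 1. For any two finite, possibly empty, sequences $\vec{\mathcal M},\vec{\mathcal M}'$ of the classes $\mathrm{BR}$ and $\mathrm{DP}$, $$\delta_{\mathrm{opt}}(\vec{\mathcal M},\mathrm{BR},\mathrm{DP},\vec{\mathcal M}';\varepsilon_g)\le\delta_{\mathrm{opt}}(\vec{\mathcal M},\mathrm{DP},\mathrm{BR},\vec{\mathcal M}';\varepsilon_g).$$ 2. Hence, among all orderings of $m$ copies of $\mathrm{DP}$ and $n$ copies of $\mathrm{BR}$, the value of $\delta_{\mathrm{opt}}(\,\cdot\,;\varepsilon_g)$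 is largest for the ordering $(\mathrm{DP},\dots,\mathrm{DP},\mathrm{BR},\dots,\mathrm{BR})$, in which all BR mechanisms come last. -/

import Mathlib

open MeasureTheory ProbabilityTheory

universe u v

namespace PrivacyOrdering

/-- A randomized algorithm with inputs in `X`: an outcome space `Out` and, for each input `x`,
the law of the random outcome on input `x`. -/
structure Mechanism (X : Type u) where
  Out : Type v
  [measurableSpaceOut : MeasurableSpace Out]
  law : X → Measure Out
  [isProbabilityMeasure_law : ∀ x, IsProbabilityMeasure (law x)]

attribute [instance] Mechanism.measurableSpaceOut Mechanism.isProbabilityMeasure_law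

variable {X : Type u}

/-- `(ε, δ)`-differential privacy with respect to the neighbouring relation `nbr`. -/
def IsDP (nbr : X → X → Prop) (ε δ : ℝ) (M : Mechanism.{u, v} X) : Prop :=
  ∀ x x' : X, nbr x x' → ∀ S : Set M.Out, MeasurableSet S →
    (M.law x).real S ≤ Real.exp ε * (M.law x').real S + δ

/-- `ε`-bounded range. The inequality between the ratios `Pr[M(x) ∈ S] / Pr[M(x') ∈ S]` is
cross-multiplied, and it is required for events rather than for single outcomes, so that outcome
spaces need not be discrete. On a countable outcome space with measurable points this is the same
as requiring it for all pairs of single outcomes (both sides are additive in each event). -/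
def IsBR (nbr : X → X → Prop) (ε : ℝ) (M : Mechanism.{u, v} X) : Prop :=
  ∀ x x' : X, nbr x x' → ∀ S₁ S₂ : Set M.Out, MeasurableSet S₁ → MeasurableSet S₂ →
    (M.law x).real S₁ * (M.law x').real S₂ ≤
      Real.exp ε * ((M.law x).real S₂ * (M.law x').real S₁)

/-- The optimal privacy parameter of a mechanism. -/
noncomputable def deltaOpt (nbr : X → X → Prop) (M : Mechanism.{u, v} X) (εg : ℝ) : ℝ :=
  sInf {δ : ℝ | 0 ≤ δ ∧ IsDP nbr εg δ M}

/-- The optimal privacy parameter of a class of mechanisms. All values `deltaOpt nbr M εg` lie in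
`[0, 1]`, so the supremum is a genuine one for every nonempty class. -/
noncomputable def deltaOptClass (nbr : X → X → Prop) (C : Set (Mechanism.{u, v} X))
    (εg : ℝ) : ℝ :=
  sSup {δ : ℝ | ∃ M ∈ C, δ = deltaOpt nbr M εg}

/-- A mechanism that also reads a past outcome `y`, with `y` held fixed: `x ↦ M₂(x, y)`. -/
abbrev Mechanism.atOutcome {Y Z : Type v} [MeasurableSpace Y] [MeasurableSpace Z]
    (K : X → Kernel Y Z) [∀ x, IsMarkovKernel (K x)] (y : Y) : Mechanism.{u, v} X where
  Out := Z
  law x := K x y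

/-- The joint mechanism `x ↦ (M₁(x), M₂(x, M₁(x)))`, where `K x y` is the law of `M₂(x, y)`. -/
noncomputable abbrev Mechanism.andThen (M₁ : Mechanism.{u, v} X) {Z : Type v} [MeasurableSpace Z]
    (K : X → Kernel M₁.Out Z) [∀ x, IsMarkovKernel (K x)] : Mechanism.{u, v} X where
  Out := M₁.Out × Z
  law x := M₁.law x ⊗ₘ K x

/-- The class `(C₁, C₂)` of adaptively selected mechanisms: a mechanism from `C₁` is run, and
then a mechanism from `C₂` that may depend on the outcome of the first one. -/
def adaptive (C₁ C₂ : Set (Mechanism.{u, v} X)) : Set (Mechanism.{u, v} X) :=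
  {M | ∃ M₁ ∈ C₁, ∃ (Z : Type v) (_ : MeasurableSpace Z) (K : X → Kernel M₁.Out Z)
      (_ : ∀ x, IsMarkovKernel (K x)),
      (∀ y : M₁.Out, Mechanism.atOutcome K y ∈ C₂) ∧ M = M₁.andThen K}

/-- The empty interaction: a single outcome that carries no information. -/
noncomputable abbrev Mechanism.empty : Mechanism.{u, v} X where
  Out := PUnit.{v + 1}
  law _ := Measure.dirac PUnit.unit

/-- The two kinds of mechanisms in an interaction: bounded range and pure DP. -/
inductive Kind
  | BR
  | DP

/-- The class of all `ε`-BR mechanisms, respectively of all (pure) `ε`-DP mechanisms. -/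
def Kind.mechanisms (nbr : X → X → Prop) (ε : ℝ) : Kind → Set (Mechanism.{u, v} X)
  | Kind.BR => {M | IsBR nbr ε M}
  | Kind.DP => {M | IsDP nbr ε 0 M}

/-- The class `(C₁, …, C_k)` of adaptively selected mechanisms for a fixed order of kinds; the
mechanism of each round may depend on the outcomes of all earlier rounds. -/
def adaptiveSeq (nbr : X → X → Prop) (ε : ℝ) (L : List Kind) : Set (Mechanism.{u, v} X) :=
  L.foldl (fun C k => adaptive C (k.mechanisms nbr ε)) {Mechanism.empty}

end PrivacyOrdering

/-!
At a fixed pair of neighbouring inputs, the optimal `δ` is a divergence whose integrand, the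
hockey-stick function `(p, q) ↦ max (p - exp εg * q) 0`, is sublinear. A divergence of an adaptive
composition is maximised backwards, by dynamic programming: the best choice of a last round of
kind `k` replaces the integrand `V` by `z ↦ ⨆ w, ∑ i, V (z * w i)`, where `w` runs over the finite
pairs of laws that the kind `k` admits, and the new integrand is again sublinear. Every `ε`-DP
pair is a post-processing of randomized response, so for a DP round this supremum is attained at
that one pair, whatever `z` and `V` are. Exchanging a BR round with a DP round is therefore the
inequality `⨆ w, ∑ b, _ ≤ ∑ b, ⨆ w, _`: it is an advantage to choose the BR round after seeing the
outcome of the DP round.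
-/

namespace PrivacyOrdering

section Sublinear

/-- Positively homogeneous subadditive functions. Sublinear functions on `ℝ × ℝ` take the role of
the integrands of `f`-divergences: such a `V` is evaluated at the pairs `(P A, Q A)`. -/
structure IsSublinear {E : Type*} [AddCommMonoid E] [Module ℝ E] (V : E → ℝ) : Prop where
  map_smul : ∀ ⦃c : ℝ⦄, 0 ≤ c → ∀ z, V (c • z) = c * V z
  map_add_le : ∀ z z', V (z + z') ≤ V z + V z'

namespace IsSublinear

theorem map_zero {E : Type*} [AddCommMonoid E] [Module ℝ E] {V : E → ℝ} (hV : IsSublinear V) :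
    V 0 = 0 := by
  simpa using hV.map_smul le_rfl 0

theorem map_sum_le {E ι : Type*} [AddCommMonoid E] [Module ℝ E] {V : E → ℝ}
    (hV : IsSublinear V) (s : Finset ι) (w : ι → E) : V (∑ i ∈ s, w i) ≤ ∑ i ∈ s, V (w i) :=
  Finset.le_sum_of_subadditive V hV.map_zero.le hV.map_add_le s w

theorem continuous {E : Type*} [NormedAddCommGroup E] [NormedSpace ℝ E] [FiniteDimensional ℝ E]
    {V : E → ℝ} (hV : IsSublinear V) : Continuous V := by
  have hconvex : ConvexOn ℝ Set.univ V := ⟨convex_univ, fun z _ z' _ a b ha hb _ => by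
    simpa only [hV.map_smul ha, hV.map_smul hb, smul_eq_mul] using hV.map_add_le (a • z) (b • z')⟩
  exact hconvex.locallyLipschitz.continuous

theorem comp_mul_left {V : ℝ × ℝ → ℝ} (hV : IsSublinear V) (z : ℝ × ℝ) :
    IsSublinear fun w => V (z * w) where
  map_smul c hc w := by rw [mul_smul_comm, hV.map_smul hc]
  map_add_le w w' := by simpa only [mul_add] using hV.map_add_le (z * w) (z * w')

theorem sum_le_of_nonneg {V : ℝ × ℝ → ℝ} (hV : IsSublinear V) {ι : Type*} [Fintype ι]
    {w : ι → ℝ × ℝ} (hw : ∀ i, 0 ≤ w i) :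
    ∑ i, V (w i) ≤ (∑ i, w i).1 * V (1, 0) + (∑ i, w i).2 * V (0, 1) := by
  rw [Prod.fst_sum, Prod.snd_sum, Finset.sum_mul, Finset.sum_mul, ← Finset.sum_add_distrib]
  refine Finset.sum_le_sum fun i _ => ?_
  have hsplit : w i = (w i).1 • ((1, 0) : ℝ × ℝ) + (w i).2 • ((0, 1) : ℝ × ℝ) := by ext <;> simp
  calc V (w i) ≤ V ((w i).1 • (1, 0)) + V ((w i).2 • (0, 1)) := by
        conv_lhs => rw [hsplit]
        exact hV.map_add_le _ _
    _ = (w i).1 * V (1, 0) + (w i).2 * V (0, 1) := by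
        rw [hV.map_smul (hw i).1, hV.map_smul (hw i).2]

end IsSublinear

/-- The integrand of the hockey-stick divergence of order `γ`, whose value is the least `δ` with
`P S ≤ γ * Q S + δ` for all events `S`. -/
def hockeyStick (γ : ℝ) (z : ℝ × ℝ) : ℝ :=
  max (z.1 - γ * z.2) 0

theorem isSublinear_hockeyStick (γ : ℝ) : IsSublinear (hockeyStick γ) where
  map_smul c hc z := by
    simp only [hockeyStick, Prod.smul_fst, Prod.smul_snd, smul_eq_mul, mul_max_of_nonneg _ _ hc]
    ring_nf
  map_add_le z z' := by
    simp only [hockeyStick, Prod.fst_add, Prod.snd_add]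
    refine (max_le_max_right 0 (le_of_eq ?_)).trans
      ((max_le_max_left _ (add_zero (0 : ℝ)).ge).trans max_add_add_le_max_add_max)
    ring

end Sublinear

theorem sum_ciSup_le {ι κ : Type*} [Fintype ι] [Nonempty κ] {f : ι → κ → ℝ} {c : ℝ}
    (hf : ∀ i, BddAbove (Set.range (f i))) (h : ∀ j : ι → κ, ∑ i, f i (j i) ≤ c) :
    ∑ i, ⨆ j, f i j ≤ c := by
  choose u _ hu hmem using fun i => exists_seq_tendsto_sSup (Set.range_nonempty (f i)) (hf i)
  choose j hj using hmem
  refine le_of_tendsto' (tendsto_finsetSum _ fun i _ => hu i) fun n => ?_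
  simpa only [hj] using h fun i => j i n

section Swap

variable {α β : Type*} [Preorder β] {f : List α → β} {a b : α}

theorem le_replicate_append_cons_of_swap_le
    (h : ∀ L L', f (L ++ [b, a] ++ L') ≤ f (L ++ [a, b] ++ L')) (m : ℕ) (L : List α) :
    f (b :: (List.replicate m a ++ L)) ≤ f (List.replicate m a ++ b :: L) := by
  induction m generalizing f with
  | zero => rfl
  | succ m ih =>
    calc f (b :: a :: (List.replicate m a ++ L))
      _ ≤ f (a :: b :: (List.replicate m a ++ L)) := h [] _
      _ ≤ f (a :: (List.replicate m a ++ b :: L)) :=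
        ih (f := fun L' => f (a :: L')) fun L₁ L₂ => h (a :: L₁) L₂

theorem le_replicate_append_replicate_of_swap_le
    (h : ∀ L L', f (L ++ [b, a] ++ L') ≤ f (L ++ [a, b] ++ L')) {m n : ℕ} {L : List α}
    (hL : L.Perm (List.replicate m a ++ List.replicate n b)) :
    f L ≤ f (List.replicate m a ++ List.replicate n b) := by
  induction L generalizing f m n with
  | nil => rw [hL.nil_eq]
  | cons k L ih =>
    have ih_cons {m n : ℕ} (hL' : L.Perm (List.replicate m a ++ List.replicate n b)) :
        f (k :: L) ≤ f (k :: (List.replicate m a ++ List.replicate n b)) :=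
      ih (f := fun L' => f (k :: L')) (fun L₁ L₂ => h (k :: L₁) L₂) hL'
    rcases List.mem_append.1 (hL.subset List.mem_cons_self) with hk | hk
    · obtain ⟨hm, rfl⟩ := List.mem_replicate.1 hk
      obtain ⟨m, rfl⟩ := Nat.exists_eq_succ_of_ne_zero hm
      exact ih_cons hL.cons_inv
    · obtain ⟨hn, rfl⟩ := List.mem_replicate.1 hk
      obtain ⟨n, rfl⟩ := Nat.exists_eq_succ_of_ne_zero hn
      exact (ih_cons (hL.trans List.perm_middle).cons_inv).trans
        (le_replicate_append_cons_of_swap_le h m _)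

end Swap

section Value

variable {ε : ℝ} {k : Kind} {V W : ℝ × ℝ → ℝ} {ι κ : Type*} [Fintype ι] [Fintype κ]
  {w : ι → ℝ × ℝ}

/-- The constraint that a kind of mechanisms puts on the probabilities `w i` of the outcomes `i`
at two neighbouring inputs. -/
def Kind.Bound (ε : ℝ) : Kind → (ι → ℝ × ℝ) → Prop
  | Kind.BR, w => ∀ i j, (w i).1 * (w j).2 ≤ Real.exp ε * ((w j).1 * (w i).2)
  | Kind.DP, w => ∀ i, (w i).1 ≤ Real.exp ε * (w i).2 ∧ (w i).2 ≤ Real.exp ε * (w i).1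

/-- The two coordinates of `w` are probability vectors that can be the laws of a mechanism of the
given kind at two neighbouring inputs. -/
structure Kind.IsLawPair (k : Kind) (ε : ℝ) (w : ι → ℝ × ℝ) : Prop where
  nonneg : ∀ i, 0 ≤ w i
  sum_eq_one : ∑ i, w i = 1
  bound : k.Bound ε w

/-- The best value that one round of kind `k` can achieve from `z`, a pair of probabilities of the
past at two neighbouring inputs, when `V` is the value afterwards. -/
noncomputable def stepValue (ε : ℝ) (k : Kind) (V : ℝ × ℝ → ℝ) (z : ℝ × ℝ) : ℝ :=
  ⨆ w : Σ n : ℕ, {w : Fin n → ℝ × ℝ // k.IsLawPair ε w}, ∑ i, V (z * w.2.1 i)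

/-- The best value that rounds of the kinds in `L` can achieve when `V` is the value afterwards,
computed backwards by dynamic programming. -/
noncomputable def listValue (ε : ℝ) (L : List Kind) (V : ℝ × ℝ → ℝ) : ℝ × ℝ → ℝ :=
  L.foldr (stepValue ε) V

namespace Kind.IsLawPair

theorem le_one (h : k.IsLawPair ε w) (i : ι) : w i ≤ 1 :=
  h.sum_eq_one ▸ Finset.single_le_sum (fun j _ => h.nonneg j) (Finset.mem_univ i)

theorem swap (h : k.IsLawPair ε w) : k.IsLawPair ε fun i => (w i).swap where
  nonneg i := (h.nonneg i).symm
  sum_eq_one := by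
    simpa [Prod.ext_iff, Prod.fst_sum, Prod.snd_sum, and_comm] using h.sum_eq_one
  bound := by
    cases k with
    | BR => exact fun i j => by simpa [mul_comm] using h.bound j i
    | DP => exact fun i => (h.bound i).symm

theorem diag_fst (hε : 0 ≤ ε) (h : k.IsLawPair ε w) :
    k.IsLawPair ε fun i => ((w i).1, (w i).1) where
  nonneg i := ⟨(h.nonneg i).1, (h.nonneg i).1⟩
  sum_eq_one := by
    have hfst := congrArg Prod.fst h.sum_eq_one
    rw [Prod.fst_sum] at hfst
    ext <;> simpa [Prod.fst_sum, Prod.snd_sum] using hfst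
  bound := by
    have hle {t : ℝ} (ht : 0 ≤ t) : t ≤ Real.exp ε * t :=
      le_mul_of_one_le_left ht (Real.one_le_exp hε)
    cases k with
    | BR =>
      intro i j
      simpa only [mul_comm] using hle (mul_nonneg (h.nonneg i).1 (h.nonneg j).1)
    | DP => exact fun i => ⟨hle (h.nonneg i).1, hle (h.nonneg i).1⟩

theorem extend (h : k.IsLawPair ε w) {e : ι → κ} (he : e.Injective) :
    k.IsLawPair ε (Function.extend e w 0) := by
  have hext (j : κ) : (∃ i, Function.extend e w 0 j = w i) ∨ Function.extend e w 0 j = 0 := by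
    by_cases hj : ∃ i, e i = j
    · obtain ⟨i, rfl⟩ := hj
      exact .inl ⟨i, he.extend_apply _ _ _⟩
    · exact .inr (Function.extend_apply' _ _ _ hj)
  refine ⟨fun j => ?_, ?_, ?_⟩
  · rcases hext j with ⟨i, hi⟩ | hi <;> rw [hi]
    exact h.nonneg i
  · rw [← h.sum_eq_one]
    exact (Fintype.sum_of_injective e he w (Function.extend e w 0)
      (Function.extend_apply' w (0 : κ → ℝ × ℝ)) fun i => (he.extend_apply w _ i).symm).symm
  · cases k with
    | BR =>
      intro i j
      rcases hext i with ⟨i', hi⟩ | hi <;> rcases hext j with ⟨j', hj⟩ | hj <;> rw [hi, hj]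
      · exact h.bound i' j'
      all_goals simp
    | DP =>
      intro i
      rcases hext i with ⟨i', hi⟩ | hi <;> rw [hi]
      · exact h.bound i'
      · simp

end Kind.IsLawPair

theorem Kind.isLawPair_one [Unique ι] (hε : 0 ≤ ε) (k : Kind) :
    k.IsLawPair ε (1 : ι → ℝ × ℝ) where
  nonneg _ := zero_le_one
  sum_eq_one := by simp
  bound := by
    cases k <;> simp [Kind.Bound, hε]

theorem sum_mul_le_of_isLawPair (hV : IsSublinear V) (h : k.IsLawPair ε w) (z : ℝ × ℝ) :
    ∑ i, V (z * w i) ≤ V (z * (1, 0)) + V (z * (0, 1)) := by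
  simpa only [h.sum_eq_one, Prod.fst_one, Prod.snd_one, one_mul]
    using (hV.comp_mul_left z).sum_le_of_nonneg h.nonneg

theorem bddAbove_stepValue (hV : IsSublinear V) (z : ℝ × ℝ) :
    BddAbove (Set.range fun w : Σ n : ℕ, {w : Fin n → ℝ × ℝ // k.IsLawPair ε w} =>
      ∑ i, V (z * w.2.1 i)) :=
  ⟨_, Set.forall_mem_range.2 fun w => sum_mul_le_of_isLawPair hV w.2.2 z⟩

theorem sum_le_stepValue (hV : IsSublinear V) (h : k.IsLawPair ε w) (z : ℝ × ℝ) :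
    ∑ i, V (z * w i) ≤ stepValue ε k V z := by
  classical
  let e := Fintype.equivFin ι
  have hw : k.IsLawPair ε (w ∘ e.symm) := by
    rw [← show Function.extend e w 0 = w ∘ e.symm from funext (e.extend_apply w 0)]
    exact h.extend e.injective
  rw [← Equiv.sum_comp e.symm]
  exact le_ciSup (bddAbove_stepValue hV z) ⟨_, _, hw⟩

theorem nonempty_isLawPair (hε : 0 ≤ ε) (k : Kind) :
    Nonempty (Σ n : ℕ, {w : Fin n → ℝ × ℝ // k.IsLawPair ε w}) :=
  ⟨1, 1, k.isLawPair_one hε⟩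

theorem stepValue_le {z : ℝ × ℝ} {c : ℝ} (hε : 0 ≤ ε)
    (h : ∀ (n : ℕ) (w : Fin n → ℝ × ℝ), k.IsLawPair ε w → ∑ i, V (z * w i) ≤ c) :
    stepValue ε k V z ≤ c :=
  have := nonempty_isLawPair hε k
  ciSup_le fun w => h w.1 w.2.1 w.2.2

theorem stepValue_mono (hε : 0 ≤ ε) (hW : IsSublinear W) (hVW : ∀ z, V z ≤ W z) (z : ℝ × ℝ) :
    stepValue ε k V z ≤ stepValue ε k W z :=
  stepValue_le hε fun _ _ hw =>
    (Finset.sum_le_sum fun _ _ => hVW _).trans (sum_le_stepValue hW hw z)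

theorem IsSublinear.stepValue (hε : 0 ≤ ε) (hV : IsSublinear V) (k : Kind) :
    IsSublinear (stepValue ε k V) where
  map_smul c hc z := by
    simp only [PrivacyOrdering.stepValue, smul_mul_assoc, hV.map_smul hc, ← Finset.mul_sum,
      Real.mul_iSup_of_nonneg hc]
  map_add_le z z' := stepValue_le hε fun n w hw =>
    calc ∑ i, V ((z + z') * w i)
      _ ≤ ∑ i, (V (z * w i) + V (z' * w i)) :=
        Finset.sum_le_sum fun i _ => by rw [add_mul]; exact hV.map_add_le _ _
      _ = ∑ i, V (z * w i) + ∑ i, V (z' * w i) := Finset.sum_add_distrib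
      _ ≤ PrivacyOrdering.stepValue ε k V z + PrivacyOrdering.stepValue ε k V z' :=
        add_le_add (sum_le_stepValue hV hw z) (sum_le_stepValue hV hw z')

theorem IsSublinear.listValue (hε : 0 ≤ ε) (hV : IsSublinear V) (L : List Kind) :
    IsSublinear (listValue ε L V) := by
  induction L with
  | nil => exact hV
  | cons k L ih => exact ih.stepValue hε k

theorem listValue_append (L L' : List Kind) :
    listValue ε (L ++ L') V = listValue ε L (listValue ε L' V) :=
  List.foldr_append

theorem listValue_mono (hε : 0 ≤ ε) (hW : IsSublinear W) (hVW : ∀ z, V z ≤ W z) (L : List Kind)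
    (z : ℝ × ℝ) : listValue ε L V z ≤ listValue ε L W z := by
  induction L generalizing z with
  | nil => exact hVW z
  | cons k L ih => exact stepValue_mono hε (hW.listValue hε L) ih z

/-- The probabilities of the two answers of randomized response at two neighbouring inputs, the
extremal law pair among those of kind `Kind.DP`. -/
noncomputable def randomizedResponse (ε : ℝ) : Bool → ℝ × ℝ
  | true => (1 + Real.exp ε)⁻¹ • (Real.exp ε, 1)
  | false => (1 + Real.exp ε)⁻¹ • (1, Real.exp ε)

theorem isLawPair_randomizedResponse (hε : 0 ≤ ε) :
    Kind.DP.IsLawPair ε (randomizedResponse ε) := by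
  have hexp : 1 ≤ Real.exp ε := Real.one_le_exp hε
  have hinv : 0 ≤ (1 + Real.exp ε)⁻¹ := by positivity
  have hbound {s t : ℝ} (hst : s ≤ Real.exp ε * t) :
      (1 + Real.exp ε)⁻¹ * s ≤ Real.exp ε * ((1 + Real.exp ε)⁻¹ * t) := by
    rw [mul_left_comm]
    exact mul_le_mul_of_nonneg_left hst hinv
  refine ⟨?_, ?_, ?_⟩
  · rintro (_ | _) <;> exact smul_nonneg hinv ⟨by positivity, by positivity⟩
  · rw [Fintype.sum_bool, randomizedResponse, randomizedResponse, ← smul_add]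
    ext <;> simp only [Prod.mk_add_mk, Prod.smul_mk, smul_eq_mul, Prod.fst_one, Prod.snd_one]
    · field_simp
      ring
    · field_simp
  · rintro (_ | _) <;> exact ⟨hbound (by nlinarith), hbound (by nlinarith)⟩

theorem Kind.IsLawPair.exists_eq_sum_smul_randomizedResponse (hε : 0 ≤ ε)
    (h : Kind.DP.IsLawPair ε w) :
    ∃ u : Bool → ι → ℝ, (∀ b i, 0 ≤ u b i) ∧ (∀ b, ∑ i, u b i = 1) ∧
      ∀ i, w i = ∑ b, u b i • randomizedResponse ε b := by
  have hfst : ∑ i, (w i).1 = 1 := by rw [← Prod.fst_sum, h.sum_eq_one, Prod.fst_one]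
  have hsnd : ∑ i, (w i).2 = 1 := by rw [← Prod.snd_sum, h.sum_eq_one, Prod.snd_one]
  rcases hε.eq_or_lt with rfl | hε
  · refine ⟨fun _ i => (w i).1, fun _ i => (h.nonneg i).1, fun _ => hfst, fun i => ?_⟩
    have hdiag := h.bound i
    simp only [Real.exp_zero, one_mul] at hdiag
    rw [Fintype.sum_bool, randomizedResponse, randomizedResponse, Real.exp_zero]
    ext
    · simp only [Prod.smul_mk, Prod.mk_add_mk, smul_eq_mul]
      ring
    · simp only [Prod.smul_mk, Prod.mk_add_mk, smul_eq_mul]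
      linarith
  · have hE : 0 < Real.exp ε - 1 := sub_pos.2 (Real.one_lt_exp_iff.2 hε)
    refine ⟨fun b i => ((if b then Real.exp ε * (w i).1 - (w i).2 else
      Real.exp ε * (w i).2 - (w i).1) / (Real.exp ε - 1)), ?_, ?_, fun i => ?_⟩
    · rintro (_ | _) i
      exacts [div_nonneg (sub_nonneg.2 (h.bound i).1) hE.le,
        div_nonneg (sub_nonneg.2 (h.bound i).2) hE.le]
    · rintro (_ | _) <;>
        simp [← Finset.sum_div, Finset.sum_sub_distrib, ← Finset.mul_sum, hfst, hsnd, hE.ne']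
    · have hE' : 1 + Real.exp ε ≠ 0 := by positivity
      rw [Fintype.sum_bool, randomizedResponse, randomizedResponse]
      ext <;> simp only [Prod.smul_mk, Prod.mk_add_mk, smul_eq_mul, if_true,
          Bool.false_eq_true, if_false] <;>
        field_simp <;> ring

theorem sum_le_sum_randomizedResponse (hε : 0 ≤ ε) (hV : IsSublinear V)
    (h : Kind.DP.IsLawPair ε w) :
    ∑ i, V (w i) ≤ ∑ b, V (randomizedResponse ε b) := by
  obtain ⟨u, hu, husum, hw⟩ := h.exists_eq_sum_smul_randomizedResponse hε
  calc ∑ i, V (w i)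
    _ ≤ ∑ i, ∑ b, u b i * V (randomizedResponse ε b) :=
      Finset.sum_le_sum fun i _ => by
        rw [hw i]
        simpa only [hV.map_smul (hu _ i)] using
          hV.map_sum_le Finset.univ fun b => u b i • randomizedResponse ε b
    _ = ∑ b, V (randomizedResponse ε b) := by
      rw [Finset.sum_comm]
      simp only [← Finset.sum_mul, husum, one_mul]

theorem stepValue_DP (hε : 0 ≤ ε) (hV : IsSublinear V) (z : ℝ × ℝ) :
    stepValue ε Kind.DP V z = ∑ b, V (z * randomizedResponse ε b) :=
  le_antisymm
    (stepValue_le hε fun _ _ hw => sum_le_sum_randomizedResponse hε (hV.comp_mul_left z) hw)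
    (sum_le_stepValue hV (isLawPair_randomizedResponse hε) z)

theorem stepValue_stepValue_DP_le (hε : 0 ≤ ε) (hV : IsSublinear V) (k : Kind) (z : ℝ × ℝ) :
    stepValue ε k (stepValue ε Kind.DP V) z ≤ stepValue ε Kind.DP (stepValue ε k V) z := by
  refine stepValue_le hε fun n w hw => ?_
  calc ∑ i, stepValue ε Kind.DP V (z * w i)
    _ = ∑ b, ∑ i, V (z * randomizedResponse ε b * w i) := by
      simp only [stepValue_DP hε hV, mul_right_comm z]
      exact Finset.sum_comm
    _ ≤ ∑ b, stepValue ε k V (z * randomizedResponse ε b) :=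
      Finset.sum_le_sum fun b _ => sum_le_stepValue hV hw _
    _ = stepValue ε Kind.DP (stepValue ε k V) z := (stepValue_DP hε (hV.stepValue hε k) z).symm

theorem listValue_BR_DP_le (hε : 0 ≤ ε) (hV : IsSublinear V) (L L' : List Kind) (z : ℝ × ℝ) :
    listValue ε (L ++ [Kind.BR, Kind.DP] ++ L') V z ≤
      listValue ε (L ++ [Kind.DP, Kind.BR] ++ L') V z := by
  simp only [listValue_append]
  have hL' := hV.listValue hε L'
  exact listValue_mono hε ((hL'.stepValue hε Kind.BR).stepValue hε Kind.DP)
    (stepValue_stepValue_DP_le hε hL' Kind.BR) L z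

end Value

section Divergence

variable {Y ι : Type*} [MeasurableSpace Y] {V : ℝ × ℝ → ℝ} {P Q : Measure Y}

/-- The masses that two measures give to the cell `φ = i` of a finite measurable partition. -/
noncomputable def cellMass (P Q : Measure Y) (φ : SimpleFunc Y ι) (i : ι) : ℝ × ℝ :=
  (P.real (φ ⁻¹' {i}), Q.real (φ ⁻¹' {i}))

/-- The `f`-divergence of two measures with sublinear integrand `V`, as a supremum over finite
measurable partitions, which avoids densities. -/
noncomputable def divergence (V : ℝ × ℝ → ℝ) (P Q : Measure Y) : ℝ :=
  ⨆ φ : Σ n : ℕ, SimpleFunc Y (Fin n), ∑ i, V (cellMass P Q φ.2 i)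

theorem cellMass_nonneg (φ : SimpleFunc Y ι) (i : ι) : 0 ≤ cellMass P Q φ i :=
  ⟨measureReal_nonneg, measureReal_nonneg⟩

theorem cellMass_eq_zero {φ : SimpleFunc Y ι} {i : ι} (hi : i ∉ φ.range) :
    cellMass P Q φ i = 0 := by
  rw [SimpleFunc.mem_range, ← Set.preimage_singleton_eq_empty] at hi
  rw [cellMass, hi, measureReal_empty, measureReal_empty, Prod.mk_zero_zero]

theorem divergence_le {c : ℝ}
    (h : ∀ (n : ℕ) (φ : SimpleFunc Y (Fin n)), ∑ i, V (cellMass P Q φ i) ≤ c) :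
    divergence V P Q ≤ c :=
  have : Nonempty (Σ n : ℕ, SimpleFunc Y (Fin n)) := ⟨1, .const Y 0⟩
  ciSup_le fun φ => h φ.1 φ.2

variable [IsFiniteMeasure P] [IsFiniteMeasure Q]

theorem sum_cellMass [Fintype ι] (φ : SimpleFunc Y ι) :
    ∑ i, cellMass P Q φ i = (P.real Set.univ, Q.real Set.univ) := by
  have hsum (μ : Measure Y) [IsFiniteMeasure μ] : ∑ i, μ.real (φ ⁻¹' {i}) = μ.real Set.univ := by
    rw [sum_measureReal_preimage_singleton _ fun i _ => φ.measurableSet_fiber i, Finset.coe_univ,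
      Set.preimage_univ]
  ext
  · simpa only [Prod.fst_sum, cellMass] using hsum P
  · simpa only [Prod.snd_sum, cellMass] using hsum Q

theorem bddAbove_divergence (hV : IsSublinear V) :
    BddAbove (Set.range fun φ : Σ n : ℕ, SimpleFunc Y (Fin n) =>
      ∑ i, V (cellMass P Q φ.2 i)) := by
  refine ⟨P.real Set.univ * V (1, 0) + Q.real Set.univ * V (0, 1),
    Set.forall_mem_range.2 fun φ => ?_⟩
  simpa only [sum_cellMass] using hV.sum_le_of_nonneg (cellMass_nonneg (P := P) (Q := Q) φ.2)

theorem sum_range_le_divergence (hV : IsSublinear V) (φ : SimpleFunc Y ι) :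
    ∑ i ∈ φ.range, V (cellMass P Q φ i) ≤ divergence V P Q := by
  let e := φ.range.equivFin
  let ψ : SimpleFunc Y (Fin φ.range.card) :=
    { toFun := fun y => e ⟨φ y, φ.mem_range_self y⟩
      measurableSet_fiber' := fun j => by
        simpa [Set.preimage, ← e.eq_symm_apply, Subtype.ext_iff]
          using φ.measurableSet_fiber (e.symm j)
      finite_range' := Set.toFinite _ }
  have hψ (i : φ.range) : cellMass P Q ψ (e i) = cellMass P Q φ i := by
    have : ψ ⁻¹' {e i} = φ ⁻¹' {↑i} := by
      ext y
      simp [ψ, Subtype.ext_iff]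
    rw [cellMass, cellMass, this]
  calc ∑ i ∈ φ.range, V (cellMass P Q φ i)
    _ = ∑ i : φ.range, V (cellMass P Q φ i) := (Finset.sum_coe_sort _ _).symm
    _ = ∑ j, V (cellMass P Q ψ j) := by
      simp only [← hψ, Equiv.sum_comp e fun j => V (cellMass P Q ψ j)]
    _ ≤ divergence V P Q := le_ciSup (bddAbove_divergence hV) ⟨_, ψ⟩

theorem sum_le_divergence [Fintype ι] (hV : IsSublinear V) (φ : SimpleFunc Y ι) :
    ∑ i, V (cellMass P Q φ i) ≤ divergence V P Q := by
  rw [← Finset.sum_subset (Finset.subset_univ φ.range) fun i _ hi => by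
    rw [cellMass_eq_zero hi, hV.map_zero]]
  exact sum_range_le_divergence hV φ

theorem divergence_self (hV : IsSublinear V) : divergence V P P = P.real Set.univ * V 1 := by
  have hsum (n : ℕ) (φ : SimpleFunc Y (Fin n)) :
      ∑ i, V (cellMass P P φ i) = P.real Set.univ * V 1 := by
    have hcell (i : Fin n) : cellMass P P φ i = P.real (φ ⁻¹' {i}) • 1 := by
      ext <;> simp [cellMass]
    simp only [hcell, hV.map_smul measureReal_nonneg]
    rw [← Finset.sum_mul]
    congr 1
    simpa only [Prod.fst_sum, cellMass] using congrArg Prod.fst (sum_cellMass (P := P) (Q := P) φ)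
  exact le_antisymm (divergence_le fun n φ => (hsum n φ).le)
    ((hsum 1 (.const Y 0)).ge.trans (sum_le_divergence hV _))

end Divergence

section CompProd

variable {Y Z ι : Type*} [MeasurableSpace Y] [MeasurableSpace Z] {ε : ℝ} {k : Kind}
  {V : ℝ × ℝ → ℝ} {P Q : Measure Y}

theorem measureReal_compProd_eq_integral [SFinite P] {K : Kernel Y Z} [IsMarkovKernel K]
    {S : Set (Y × Z)} (hS : MeasurableSet S) :
    (P ⊗ₘ K).real S = ∫ y, (K y).real (Prod.mk y ⁻¹' S) ∂P := by
  rw [measureReal_def, Measure.compProd_apply hS]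
  refine (integral_toReal (Kernel.measurable_kernel_prodMk_left hS).aemeasurable ?_).symm
  exact .of_forall fun y => measure_lt_top _ _

theorem measureReal_compProd_prod_of_forall_eq [SFinite P] {K : Kernel Y Z} [IsMarkovKernel K]
    {S : Set Y} {T : Set Z} (hS : MeasurableSet S) (hT : MeasurableSet T) {c : ℝ}
    (h : ∀ y ∈ S, (K y).real T = c) : (P ⊗ₘ K).real (S ×ˢ T) = P.real S * c := by
  rw [measureReal_compProd_eq_integral (hS.prod hT), ← smul_eq_mul, ← setIntegral_const,
    ← integral_indicator hS]
  congr with y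
  by_cases hy : y ∈ S
  · rw [Set.mk_preimage_prod_right hy, Set.indicator_of_mem hy, h y hy]
  · rw [Set.mk_preimage_prod_right_eq_empty hy, Set.indicator_of_notMem hy, measureReal_empty]

variable [Fintype ι]

theorem sum_integral_simpleFunc_le_divergence [IsFiniteMeasure P] [IsFiniteMeasure Q]
    (hε : 0 ≤ ε) (hV : IsSublinear V) (g : SimpleFunc Y (ι → ℝ × ℝ))
    (hg : ∀ y, k.IsLawPair ε (g y)) :
    ∑ i, V (∫ y, (g y i).1 ∂P, ∫ y, (g y i).2 ∂Q) ≤ divergence (stepValue ε k V) P Q := by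
  have hintegral (i : ι) : (∫ y, (g y i).1 ∂P, ∫ y, (g y i).2 ∂Q) =
      ∑ w ∈ g.range, cellMass P Q g w * w i := by
    have hsum (μ : Measure Y) [IsFiniteMeasure μ] (π : (ι → ℝ × ℝ) → ℝ) (hπ : π 0 = 0) :
        ∫ y, π (g y) ∂μ = ∑ w ∈ g.range, μ.real (g ⁻¹' {w}) * π w :=
      (SimpleFunc.integral_eq_integral (g.map π)
        (SimpleFunc.integrable_of_isFiniteMeasure _)).symm.trans
          (SimpleFunc.map_integral g π (SimpleFunc.integrable_of_isFiniteMeasure g) hπ)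
    ext
    · simpa only [Prod.fst_sum, Prod.fst_mul, cellMass] using hsum P (fun w => (w i).1) rfl
    · simpa only [Prod.snd_sum, Prod.snd_mul, cellMass] using hsum Q (fun w => (w i).2) rfl
  calc ∑ i, V (∫ y, (g y i).1 ∂P, ∫ y, (g y i).2 ∂Q)
    _ ≤ ∑ i, ∑ w ∈ g.range, V (cellMass P Q g w * w i) :=
      Finset.sum_le_sum fun i _ => (hintegral i).symm ▸ hV.map_sum_le g.range _
    _ = ∑ w ∈ g.range, ∑ i, V (cellMass P Q g w * w i) := Finset.sum_comm
    _ ≤ ∑ w ∈ g.range, stepValue ε k V (cellMass P Q g w) := by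
      refine Finset.sum_le_sum fun w hw => ?_
      obtain ⟨y, rfl⟩ := SimpleFunc.mem_range.1 hw
      exact sum_le_stepValue hV (hg y) _
    _ ≤ divergence (stepValue ε k V) P Q := sum_range_le_divergence (hV.stepValue hε k) g

variable [IsProbabilityMeasure P] [IsProbabilityMeasure Q]

theorem sum_integral_le_divergence (hε : 0 ≤ ε) (hV : IsSublinear V) {f : Y → ι → ℝ × ℝ}
    (hf : Measurable f) (hfk : ∀ y, k.IsLawPair ε (f y)) :
    ∑ i, V (∫ y, (f y i).1 ∂P, ∫ y, (f y i).2 ∂Q) ≤ divergence (stepValue ε k V) P Q := by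
  obtain ⟨y₀⟩ := nonempty_of_isProbabilityMeasure P
  let g := SimpleFunc.approxOn f hf (Set.range f) (f y₀) (Set.mem_range_self y₀)
  have hg (n : ℕ) (y : Y) : k.IsLawPair ε (g n y) := by
    obtain ⟨y', hy'⟩ := SimpleFunc.approxOn_mem hf (Set.mem_range_self y₀) n y
    exact hy' ▸ hfk y'
  have hlim (y : Y) (i : ι) : Filter.Tendsto (fun n => g n y i) Filter.atTop (nhds (f y i)) :=
    tendsto_pi_nhds.1 (SimpleFunc.tendsto_approxOn hf _ (subset_closure (Set.mem_range_self y))) i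
  have hintegral {π : ℝ × ℝ → ℝ} (hπ : Continuous π) (hπ1 : ∀ z, 0 ≤ z → z ≤ 1 → ‖π z‖ ≤ 1)
      (μ : Measure Y) [IsProbabilityMeasure μ] (i : ι) :
      Filter.Tendsto (fun n => ∫ y, π (g n y i) ∂μ) Filter.atTop (nhds (∫ y, π (f y i) ∂μ)) := by
    refine tendsto_integral_of_dominated_convergence (fun _ => 1) (fun n => ?_)
      (integrable_const _) (fun n => ?_) ?_
    · exact (hπ.measurable.comp
        ((measurable_pi_apply i).comp (g n).measurable)).aestronglyMeasurable
    · exact .of_forall fun y => hπ1 _ ((hg n y).nonneg i) ((hg n y).le_one i)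
    · exact .of_forall fun y => (hπ.tendsto _).comp (hlim y i)
  refine le_of_tendsto' (tendsto_finsetSum _ fun i _ => (hV.continuous.tendsto _).comp
    ((hintegral continuous_fst ?_ P i).prodMk_nhds (hintegral continuous_snd ?_ Q i)))
    fun n => sum_integral_simpleFunc_le_divergence hε hV (g n) (hg n)
  · exact fun z h0 h1 => by simpa [abs_of_nonneg h0.1] using h1.1
  · exact fun z h0 h1 => by simpa [abs_of_nonneg h0.2] using h1.2

theorem divergence_compProd_le (hε : 0 ≤ ε) (hV : IsSublinear V) {K K' : Kernel Y Z}
    [IsMarkovKernel K] [IsMarkovKernel K']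
    (h : ∀ y (n : ℕ) (φ : SimpleFunc Z (Fin n)), k.IsLawPair ε (cellMass (K y) (K' y) φ)) :
    divergence V (P ⊗ₘ K) (Q ⊗ₘ K') ≤ divergence (stepValue ε k V) P Q := by
  refine divergence_le fun n φ => ?_
  let f (y : Y) : Fin n → ℝ × ℝ :=
    cellMass (K y) (K' y) (φ.comp (Prod.mk y) measurable_prodMk_left)
  have hf : Measurable f := measurable_pi_lambda _ fun i =>
    (Kernel.measurable_kernel_prodMk_left (φ.measurableSet_fiber i)).ennreal_toReal.prodMk
      (Kernel.measurable_kernel_prodMk_left (φ.measurableSet_fiber i)).ennreal_toReal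
  have hcell (i : Fin n) : cellMass (P ⊗ₘ K) (Q ⊗ₘ K') φ i =
      (∫ y, (f y i).1 ∂P, ∫ y, (f y i).2 ∂Q) := by
    simp only [cellMass, f, measureReal_compProd_eq_integral (φ.measurableSet_fiber i)]
    rfl
  simpa only [hcell] using sum_integral_le_divergence hε hV hf fun y => h y n _

end CompProd

section Mechanisms

variable {X : Type u} {nbr : X → X → Prop} {ε : ℝ} {k : Kind} {V : ℝ × ℝ → ℝ} {x x' : X}
  {L : List Kind}

theorem adaptiveSeq_concat (L : List Kind) (k : Kind) :
    adaptiveSeq.{u, v} nbr ε (L ++ [k]) = adaptive (adaptiveSeq nbr ε L) (k.mechanisms nbr ε) :=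
  List.foldl_concat ..

theorem isLawPair_cellMass {ι : Type*} [Fintype ι] (hsymm : ∀ x x', nbr x x' → nbr x' x)
    {M : Mechanism.{u, v} X} (hM : M ∈ k.mechanisms nbr ε) (hnbr : nbr x x')
    (φ : SimpleFunc M.Out ι) : k.IsLawPair ε (cellMass (M.law x) (M.law x') φ) where
  nonneg := cellMass_nonneg φ
  sum_eq_one := by rw [sum_cellMass, probReal_univ, probReal_univ, Prod.mk_one_one]
  bound := by
    have hφ (i : ι) : MeasurableSet (φ ⁻¹' {i}) := φ.measurableSet_fiber i
    cases k with
    | BR => exact fun i j => hM x x' hnbr _ _ (hφ i) (hφ j)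
    | DP =>
      intro i
      have hxx' := hM x x' hnbr _ (hφ i)
      have hx'x := hM x' x (hsymm x x' hnbr) _ (hφ i)
      rw [add_zero] at hxx' hx'x
      exact ⟨hxx', hx'x⟩

theorem divergence_le_listValue (hε : 0 ≤ ε) (hV : IsSublinear V)
    (hsymm : ∀ x x', nbr x x' → nbr x' x) (hnbr : nbr x x') {M : Mechanism.{u, v} X}
    (hM : M ∈ adaptiveSeq nbr ε L) : divergence V (M.law x) (M.law x') ≤ listValue ε L V 1 := by
  induction L using List.reverseRecOn generalizing V M with
  | nil =>
    obtain rfl : M = Mechanism.empty := hM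
    rw [divergence_self hV, probReal_univ, one_mul]
    rfl
  | append_singleton L k ih =>
    rw [adaptiveSeq_concat] at hM
    obtain ⟨M₁, hM₁, Z, _, K, _, hK, rfl⟩ := hM
    rw [listValue_append]
    exact (divergence_compProd_le hε hV fun y _ φ => isLawPair_cellMass hsymm (hK y) hnbr φ).trans
      (ih (hV.stepValue hε k) hM₁)

theorem exists_pmf_toReal_eq {κ : Type*} [Fintype κ] {p : κ → ℝ} (hp : ∀ j, 0 ≤ p j)
    (hsum : ∑ j, p j = 1) : ∃ μ : PMF κ, ∀ j, (μ j).toReal = p j :=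
  ⟨PMF.ofFintype (fun j => ENNReal.ofReal (p j)) (by
    rw [← ENNReal.ofReal_sum_of_nonneg fun j _ => hp j, hsum, ENNReal.ofReal_one]),
    fun j => by rw [PMF.ofFintype_apply, ENNReal.toReal_ofReal (hp j)]⟩

theorem Kind.IsLawPair.exists_pmf_family {κ : Type*} [Fintype κ] {w : κ → ℝ × ℝ} (hε : 0 ≤ ε)
    (hw : k.IsLawPair ε w) (hne : x ≠ x') :
    ∃ μ : X → PMF κ, (∀ t t', k.IsLawPair ε fun j => ((μ t j).toReal, (μ t' j).toReal)) ∧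
      ∀ j, ((μ x j).toReal, (μ x' j).toReal) = w j := by
  classical
  obtain ⟨P, hP⟩ := exists_pmf_toReal_eq (fun j => (hw.nonneg j).1)
    (by rw [← Prod.fst_sum, hw.sum_eq_one, Prod.fst_one])
  obtain ⟨Q, hQ⟩ := exists_pmf_toReal_eq (fun j => (hw.nonneg j).2)
    (by rw [← Prod.snd_sum, hw.sum_eq_one, Prod.snd_one])
  refine ⟨fun t => if t = x' then Q else P, fun t t' => ?_, fun j => ?_⟩
  · by_cases ht : t = x' <;> by_cases ht' : t' = x' <;>
      simp only [ht, ht', if_true, if_false, hP, hQ]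
    exacts [hw.swap.diag_fst hε, hw.swap, hw, hw.diag_fst hε]
  · simp only [hne, if_true, if_false, hP, hQ]

theorem mem_mechanisms_of_bound_singleton (M : Mechanism.{u, v} X) [Finite M.Out]
    [MeasurableSingletonClass M.Out]
    (h : ∀ x x', nbr x x' → k.Bound ε fun y => ((M.law x).real {y}, (M.law x').real {y})) :
    M ∈ k.mechanisms nbr ε := by
  classical
  have := Fintype.ofFinite M.Out
  have hsum (x : X) (S : Set M.Out) : (M.law x).real S = ∑ y ∈ S.toFinset, (M.law x).real {y} := by
    rw [sum_measureReal_singleton, Set.coe_toFinset]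
  cases k with
  | BR =>
    intro x x' hnbr S₁ S₂ _ _
    rw [hsum, hsum x', hsum x S₂, hsum x' S₁, Finset.sum_mul_sum, Finset.sum_mul_sum,
      Finset.sum_comm, Finset.mul_sum]
    simp only [Finset.mul_sum]
    exact Finset.sum_le_sum fun z _ => Finset.sum_le_sum fun y _ => h x x' hnbr y z
  | DP =>
    intro x x' hnbr S _
    rw [hsum, hsum x', add_zero, Finset.mul_sum]
    exact Finset.sum_le_sum fun y _ => (h x x' hnbr y).1

theorem exists_mem_adaptive_cellMass_eq {ι : Type*} {κ : Type v} [Fintype κ] (hε : 0 ≤ ε)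
    (hne : x ≠ x') {C : Set (Mechanism.{u, v} X)} {M₁ : Mechanism.{u, v} X} (hM₁ : M₁ ∈ C)
    (φ : SimpleFunc M₁.Out ι) {w : ι → κ → ℝ × ℝ} (hw : ∀ i, k.IsLawPair ε (w i)) :
    ∃ M ∈ adaptive C (k.mechanisms nbr ε), ∃ ψ : SimpleFunc M.Out (ι × κ),
      ∀ i j, cellMass (M.law x) (M.law x') ψ (i, j) =
        cellMass (M₁.law x) (M₁.law x') φ i * w i j := by
  let _ : MeasurableSpace κ := ⊤
  choose μ hμ hμw using fun i => (hw i).exists_pmf_family hε hne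
  let K (t : X) : Kernel M₁.Out κ :=
    ⟨fun y => (μ (φ y) t).toMeasure, (φ.map fun i => (μ i t).toMeasure).measurable⟩
  have hK (t : X) : IsMarkovKernel (K t) := ⟨fun y => PMF.toMeasure.isProbabilityMeasure _⟩
  have hKsingleton (t : X) (y : M₁.Out) (j : κ) : (K t y).real {j} = (μ (φ y) t j).toReal := by
    rw [measureReal_def]
    exact congrArg ENNReal.toReal
      (PMF.toMeasure_apply_singleton _ _ (measurableSet_singleton j))
  let ψ : SimpleFunc (M₁.Out × κ) (ι × κ) :=
    (φ.comp Prod.fst measurable_fst).pair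
      ((SimpleFunc.ofFinite id).comp Prod.snd measurable_snd)
  have hψ (i : ι) (j : κ) : ψ ⁻¹' {(i, j)} = (φ ⁻¹' {i}) ×ˢ {j} := by
    ext y
    exact Prod.ext_iff
  refine ⟨M₁.andThen K, ⟨M₁, hM₁, κ, _, K, hK, fun y => ?_, rfl⟩, ψ, fun i j => ?_⟩
  · refine mem_mechanisms_of_bound_singleton (Mechanism.atOutcome K y) fun t t' _ => ?_
    simpa only [hKsingleton] using (hμ (φ y) t t').bound
  · have hcell (t : X) : (M₁.law t ⊗ₘ K t).real ((φ ⁻¹' {i}) ×ˢ {j}) =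
        (M₁.law t).real (φ ⁻¹' {i}) * (μ i t j).toReal :=
      measureReal_compProd_prod_of_forall_eq (φ.measurableSet_fiber i)
        (measurableSet_singleton j) fun y hy => by rw [hKsingleton, show φ y = i from hy]
    simp only [cellMass, hψ, hcell, ← hμw, Prod.mk_mul_mk]

theorem listValue_le_of_forall_divergence_le (hε : 0 ≤ ε) (hV : IsSublinear V) (hne : x ≠ x')
    {c : ℝ} (h : ∀ M ∈ adaptiveSeq.{u, v} nbr ε L, divergence V (M.law x) (M.law x') ≤ c) :
    listValue ε L V 1 ≤ c := by
  induction L using List.reverseRecOn generalizing V with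
  | nil =>
    have hempty := h Mechanism.empty rfl
    rwa [divergence_self hV, probReal_univ, one_mul] at hempty
  | append_singleton L k ih =>
    rw [listValue_append]
    refine ih (hV.stepValue hε k) fun M₁ hM₁ => divergence_le fun n φ => ?_
    have := nonempty_isLawPair hε k
    refine sum_ciSup_le (fun i => bddAbove_stepValue hV _) fun w => ?_
    -- One outcome space for all the pairs `w i`, since that of a round cannot vary with the past.
    let κ := ULift.{v} (Σ i, Fin (w i).1)
    let e (i : Fin n) (j : Fin (w i).1) : κ := ⟨i, j⟩
    have he (i : Fin n) : (e i).Injective :=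
      ULift.up_injective.comp sigma_mk_injective
    obtain ⟨M, hM, ψ, hψ⟩ := exists_mem_adaptive_cellMass_eq (nbr := nbr) hε hne hM₁ φ
      fun i => (w i).2.2.extend (he i)
    rw [← adaptiveSeq_concat] at hM
    calc ∑ i, ∑ j, V (cellMass (M₁.law x) (M₁.law x') φ i * (w i).2.1 j)
      _ = ∑ p, V (cellMass (M.law x) (M.law x') ψ p) := by
        simp only [Fintype.sum_prod_type, hψ]
        refine Finset.sum_congr rfl fun i _ => Fintype.sum_of_injective (e i) (he i) _ _
          (fun j hj => ?_) fun j => by rw [(he i).extend_apply]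
        rw [Function.extend_apply' _ _ _ hj, Pi.zero_apply, mul_zero, hV.map_zero]
      _ ≤ divergence V (M.law x) (M.law x') := sum_le_divergence hV ψ
      _ ≤ c := h M hM

theorem divergence_hockeyStick_le_iff {Y : Type*} [MeasurableSpace Y] {P Q : Measure Y}
    [IsFiniteMeasure P] [IsFiniteMeasure Q] {γ δ : ℝ} :
    divergence (hockeyStick γ) P Q ≤ δ ↔
      ∀ S, MeasurableSet S → P.real S ≤ γ * Q.real S + δ := by
  refine ⟨fun h S hS => ?_, fun h => divergence_le fun n φ => ?_⟩
  · let φ : SimpleFunc Y Bool := .piecewise S hS (.const Y true) (.const Y false)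
    have hφ : φ ⁻¹' {true} = S := by
      ext y
      by_cases hy : y ∈ S <;> simp [φ, hy]
    have hsum := (sum_le_divergence (P := P) (Q := Q) (isSublinear_hockeyStick γ) φ).trans h
    rw [Fintype.sum_bool, cellMass, hφ] at hsum
    linarith [le_max_left (P.real S - γ * Q.real S) 0,
      show 0 ≤ hockeyStick γ (cellMass P Q φ false) from le_max_right _ _,
      show hockeyStick γ (P.real S, Q.real S) = max (P.real S - γ * Q.real S) 0 from rfl]
  · let s : Finset (Fin n) := {i | 0 < P.real (φ ⁻¹' {i}) - γ * Q.real (φ ⁻¹' {i})}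
    have hs (μ : Measure Y) [IsFiniteMeasure μ] :
        ∑ i ∈ s, μ.real (φ ⁻¹' {i}) = μ.real (φ ⁻¹' s) :=
      sum_measureReal_preimage_singleton _ fun i _ => φ.measurableSet_fiber i
    calc ∑ i, hockeyStick γ (cellMass P Q φ i)
      _ = ∑ i ∈ s, (P.real (φ ⁻¹' {i}) - γ * Q.real (φ ⁻¹' {i})) := by
        rw [Finset.sum_filter]
        exact Finset.sum_congr rfl fun i _ => (max_comm _ _).trans (max_def_lt _ _)
      _ = P.real (φ ⁻¹' s) - γ * Q.real (φ ⁻¹' s) := by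
        rw [Finset.sum_sub_distrib, ← Finset.mul_sum, hs, hs]
      _ ≤ δ := sub_le_iff_le_add'.2 (h _ (φ.measurableSet_preimage _))

theorem isDP_iff_forall_divergence_le {M : Mechanism.{u, v} X} {δ εg : ℝ} :
    IsDP nbr εg δ M ↔ ∀ x x', nbr x x' →
      divergence (hockeyStick (Real.exp εg)) (M.law x) (M.law x') ≤ δ := by
  simp only [IsDP, divergence_hockeyStick_le_iff]

section DeltaOpt

variable {M : Mechanism.{u, v} X} {C : Set (Mechanism.{u, v} X)} {εg δ : ℝ}

theorem isDP_one (M : Mechanism.{u, v} X) (εg : ℝ) : IsDP nbr εg 1 M := fun x x' _ S _ =>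
  measureReal_le_one.trans (le_add_of_nonneg_left (by positivity))

theorem isDP_deltaOpt (M : Mechanism.{u, v} X) (εg : ℝ) : IsDP nbr εg (deltaOpt nbr M εg) M := by
  intro x x' hnbr S hS
  rw [← sub_le_iff_le_add']
  exact le_csInf ⟨1, zero_le_one, isDP_one M εg⟩ fun δ hδ =>
    sub_le_iff_le_add'.2 (hδ.2 x x' hnbr S hS)

theorem deltaOpt_le (hδ : 0 ≤ δ) (h : IsDP nbr εg δ M) : deltaOpt nbr M εg ≤ δ :=
  csInf_le ⟨0, fun _ h => h.1⟩ ⟨hδ, h⟩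

theorem isDP_deltaOptClass (hM : M ∈ C) (εg : ℝ) : IsDP nbr εg (deltaOptClass nbr C εg) M := by
  have hle : deltaOpt nbr M εg ≤ deltaOptClass nbr C εg := by
    refine le_csSup ⟨1, ?_⟩ ⟨M, hM, rfl⟩
    rintro _ ⟨M, -, rfl⟩
    exact deltaOpt_le zero_le_one (isDP_one M εg)
  exact fun x x' hnbr S hS =>
    (isDP_deltaOpt M εg x x' hnbr S hS).trans (add_le_add_right hle _)

theorem deltaOptClass_le (hδ : 0 ≤ δ) (h : ∀ M ∈ C, IsDP nbr εg δ M) :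
    deltaOptClass nbr C εg ≤ δ := by
  refine Real.sSup_le ?_ hδ
  rintro _ ⟨M, hM, rfl⟩
  exact deltaOpt_le hδ (h M hM)

theorem deltaOptClass_nonneg (C : Set (Mechanism.{u, v} X)) (εg : ℝ) :
    0 ≤ deltaOptClass nbr C εg := by
  refine Real.sSup_nonneg ?_
  rintro _ ⟨M, -, rfl⟩
  exact Real.sInf_nonneg fun _ h => h.1

end DeltaOpt

theorem adaptiveSeq_nonempty (hε : 0 ≤ ε) (L : List Kind) :
    (adaptiveSeq.{u, v} nbr ε L).Nonempty := by
  induction L using List.reverseRecOn with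
  | nil => exact ⟨_, rfl⟩
  | append_singleton L k ih =>
    obtain ⟨M, hM⟩ := ih
    rw [adaptiveSeq_concat]
    refine ⟨M.andThen fun _ => Kernel.const _ (.dirac PUnit.unit), M, hM, PUnit, _, _,
      fun _ => inferInstance, fun y => mem_mechanisms_of_bound_singleton _ fun _ _ _ => ?_, rfl⟩
    simpa [measureReal_def, Pi.one_def, ← Prod.mk_one_one]
      using (k.isLawPair_one (ι := PUnit) hε).bound

theorem deltaOptClass_adaptiveSeq_mono (hε : 0 ≤ ε) (hsymm : ∀ x x', nbr x x' → nbr x' x)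
    {L L' : List Kind} {εg : ℝ}
    (h : listValue ε L (hockeyStick (Real.exp εg)) 1 ≤
      listValue ε L' (hockeyStick (Real.exp εg)) 1) :
    deltaOptClass nbr (adaptiveSeq.{u, v} nbr ε L) εg ≤
      deltaOptClass nbr (adaptiveSeq.{u, v} nbr ε L') εg := by
  have hV := isSublinear_hockeyStick (Real.exp εg)
  refine deltaOptClass_le (deltaOptClass_nonneg _ _) fun M hM =>
    isDP_iff_forall_divergence_le.2 fun x x' hnbr => ?_
  have hL' {M'} (hM' : M' ∈ adaptiveSeq.{u, v} nbr ε L') :=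
    isDP_iff_forall_divergence_le.1 (isDP_deltaOptClass hM' εg) x x' hnbr
  rcases eq_or_ne x x' with rfl | hne
  · obtain ⟨M', hM'⟩ := adaptiveSeq_nonempty (nbr := nbr) hε L'
    calc divergence (hockeyStick (Real.exp εg)) (M.law x) (M.law x)
      _ = divergence (hockeyStick (Real.exp εg)) (M'.law x) (M'.law x) := by
        simp only [divergence_self hV, probReal_univ]
      _ ≤ deltaOptClass nbr (adaptiveSeq.{u, v} nbr ε L') εg := hL' hM'
  · calc divergence (hockeyStick (Real.exp εg)) (M.law x) (M.law x')
      _ ≤ listValue ε L (hockeyStick (Real.exp εg)) 1 :=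
        divergence_le_listValue hε hV hsymm hnbr hM
      _ ≤ listValue ε L' (hockeyStick (Real.exp εg)) 1 := h
      _ ≤ deltaOptClass nbr (adaptiveSeq.{u, v} nbr ε L') εg :=
        listValue_le_of_forall_divergence_le hε hV hne fun M' hM' => hL' hM'

end Mechanisms

end PrivacyOrdering

open PrivacyOrdering in
theorem mainTheorem4_general {X : Type u} (nbr : X → X → Prop)
    (hsymm : ∀ x x', nbr x x' → nbr x' x) (ε : ℝ) (hε : 0 ≤ ε) (εg : ℝ) :
    (∀ L L' : List Kind,
      deltaOptClass nbr
          (adaptiveSeq.{u, v} nbr ε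
            (L ++ [Kind.BR, Kind.DP] ++ L')) εg ≤
        deltaOptClass nbr
          (adaptiveSeq.{u, v} nbr ε
            (L ++ [Kind.DP, Kind.BR] ++ L')) εg) ∧
    (∀ (m n : ℕ) (L : List Kind),
      L.Perm (List.replicate m Kind.DP ++
        List.replicate n Kind.BR) →
      deltaOptClass nbr (adaptiveSeq.{u, v} nbr ε L) εg ≤
        deltaOptClass nbr
          (adaptiveSeq.{u, v} nbr ε
            (List.replicate m Kind.DP ++
              List.replicate n Kind.BR)) εg) := by
  have hswap (L L' : List Kind) :=
    deltaOptClass_adaptiveSeq_mono.{u, v} hε hsymm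
      (listValue_BR_DP_le hε
        (isSublinear_hockeyStick (Real.exp εg)) L L' 1)
  exact ⟨hswap, fun m n L hL =>
    le_replicate_append_replicate_of_swap_le
      (f := fun L => deltaOptClass nbr
        (adaptiveSeq.{u, v} nbr ε L) εg) hswap hL⟩

theorem mainTheorem4 {X : Type u} (nbr : X → X → Prop) (hsymm : ∀ x x', nbr x x' → nbr x' x)
    (ε : ℝ) (hε : 0 < ε) (εg : ℝ) (hεg : 0 ≤ εg) :
    (∀ L L' : List PrivacyOrdering.Kind,
      PrivacyOrdering.deltaOptClass nbr
          (PrivacyOrdering.adaptiveSeq.{u, v} nbr ε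
            (L ++ [PrivacyOrdering.Kind.BR, PrivacyOrdering.Kind.DP] ++ L')) εg ≤
        PrivacyOrdering.deltaOptClass nbr
          (PrivacyOrdering.adaptiveSeq.{u, v} nbr ε
            (L ++ [PrivacyOrdering.Kind.DP, PrivacyOrdering.Kind.BR] ++ L')) εg) ∧
    (∀ (m n : ℕ) (L : List PrivacyOrdering.Kind),
      L.Perm (List.replicate m PrivacyOrdering.Kind.DP ++
        List.replicate n PrivacyOrdering.Kind.BR) →
      PrivacyOrdering.deltaOptClass nbr (PrivacyOrdering.adaptiveSeq.{u, v} nbr ε L) εg ≤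
        PrivacyOrdering.deltaOptClass nbr
          (PrivacyOrdering.adaptiveSeq.{u, v} nbr ε
            (List.replicate m PrivacyOrdering.Kind.DP ++
              List.replicate n PrivacyOrdering.Kind.BR)) εg) :=
  mainTheorem4_general nbr hsymm ε hε.le εg
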